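/- Let $d\ge 1$ and $\theta,\mu\in\mathbb R^d$. In the $d$-dimensional Gaussian translation model, $Y$ is a Bernoulli$(1/2)$ variable and $X\in\mathbb R^d$ has, conditionally on $Y=1$ (resp. $Y=0$), the distribution $\mathcal N(\theta,I_d)$ (resp. $\mathcal N(\mu,I_d)$). Let $(X_1,Y_1),\dots,(X_n,Y_n)$ be i.i.d. copies of $(X,Y)$, independent of $(X,Y)$. For $1\le k\le n$ the $k$-nearest neighbours classifier is $\Phi_{k,n,d}(x)=\mathbf 1\{\frac1k\sum_{j=1}^k Y_{(j)}(x)>\frac12\}$, where $Y_{(1)}(x),\dots,Y_{(n)}(x)$ are the labels reordered so that $\|X_{(1)}-x\|\le\dots\le\|X_{(n)}-x\|$ (Euclidean norm; ties, which have probability zero, are broken by the index). Let $\gamma(x)=(2\pi)^{-d/2}e^{-\|x\|^2/2}$, let $\eta_d(x)=\gamma(x-\theta)/(\gamma(x-\theta)+\gamma(x-\mu))$, let $\Phi_d^\star(x)=\mathbf 1\{\eta_d(x)\ge \frac12\}$ be the Bayes classifier, and let $\mathcal R(\Phi)=\mathbb P(\Phi(X)\ne Y)$, the probability being over the sample and the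 pair $(X,Y)$. For every $\Delta>0$ there is a constant $C_1>0$, depending only on $\Delta$ (in particular neither on $n$, $k$ nor on $d$), such that for all $d\ge1$, all $\theta,\mu\in\mathbb R^d$ with $\|\theta-\mu\|=\Delta$, all $n$, and all $$k\in\mathcal K_n=\Big\{\ell\in\mathbb N:\ 1\le \ell\le n,\ \frac1{\sqrt \ell}\ge d\Big(\frac{\ell}{n}\Big)^{2/d}\Big\},$$ one has $$\mathcal R(\Phi_{k,n,d})-\mathcal R(\Phi_d^\star)\ \ge\ \frac{C_1}{k}.$$ Moreover $\mathcal K_n$ includes the standard optimal choice $k\asymp n^{4/(4+d)}$: for every $d\ge1$ and $0<c\le d^{-2d/(4+d)}$, and every $n$ with $c\,n^{4/(4+d)}\ge1$, the integer $k=\lfloor c\,n^{4/(4+d)}\rfloor$ belongs to $\mathcal K_n$. -/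

import Mathlib

open MeasureTheory ProbabilityTheory

namespace GaussianKNN

noncomputable section

/-- The Gaussian distribution `N(a, I_d)` on `ℝ^d`. -/
def gaussianAt {d : ℕ} (a : EuclideanSpace ℝ (Fin d)) : Measure (EuclideanSpace ℝ (Fin d)) :=
  (stdGaussian (EuclideanSpace ℝ (Fin d))).map (fun x => a + x)

/-- The law of one labelled observation `(X, Y)` in the Gaussian translation model:
`Y` is Bernoulli of parameter `1/2`, and `X` is `N(θ, I_d)` given `Y = 1` (here `true`) and
`N(μ, I_d)` given `Y = 0` (here `false`). -/
def modelLaw {d : ℕ} (θ μ : EuclideanSpace ℝ (Fin d)) :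
    Measure (EuclideanSpace ℝ (Fin d) × Bool) :=
  (2⁻¹ : ENNReal) • (gaussianAt θ).map (fun x => (x, true)) +
    (2⁻¹ : ENNReal) • (gaussianAt μ).map (fun x => (x, false))

instance isProbabilityMeasure_gaussianAt {d : ℕ} (a : EuclideanSpace ℝ (Fin d)) :
    IsProbabilityMeasure (gaussianAt a) :=
  Measure.isProbabilityMeasure_map (by fun_prop)

instance isProbabilityMeasure_modelLaw {d : ℕ} (θ μ : EuclideanSpace ℝ (Fin d)) :
    IsProbabilityMeasure (modelLaw θ μ) := by
  have h1 := Measure.isProbabilityMeasure_map (μ := gaussianAt θ)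
    (f := fun x => (x, true)) (by fun_prop)
  have h2 := Measure.isProbabilityMeasure_map (μ := gaussianAt μ)
    (f := fun x => (x, false)) (by fun_prop)
  constructor
  simp [modelLaw, ENNReal.inv_two_add_inv_two]

/-- The standard Gaussian density `γ_d` on `ℝ^d`. -/
def gaussianDensity {d : ℕ} (x : EuclideanSpace ℝ (Fin d)) : ℝ :=
  (2 * Real.pi) ^ (-(d : ℝ) / 2) * Real.exp (-‖x‖ ^ 2 / 2)

/-- The regression function `η_d(x) = P(Y = 1 | X = x)` of the model. -/
def regression {d : ℕ} (θ μ x : EuclideanSpace ℝ (Fin d)) : ℝ :=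
  gaussianDensity (x - θ) / (gaussianDensity (x - θ) + gaussianDensity (x - μ))

open Classical in
/-- The `d`-dimensional Bayes classifier `1_{η_d(x) ≥ 1/2}`. -/
def bayes {d : ℕ} (θ μ x : EuclideanSpace ℝ (Fin d)) : Bool :=
  decide (1 / 2 ≤ regression θ μ x)

/-- The permutation that lists the sample points by nondecreasing Euclidean distance to `x`:
`S (order S x 0)` is the nearest observation, and so on. Equal distances (an event of
probability zero in the model) are ordered by the index. -/
def order {d n : ℕ} (S : Fin n → EuclideanSpace ℝ (Fin d) × Bool)
    (x : EuclideanSpace ℝ (Fin d)) : Equiv.Perm (Fin n) :=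
  Tuple.sort (fun i => ‖(S i).1 - x‖)

open Classical in
/-- The `k`-nearest neighbours classifier built on the sample `S` of size `n`: it answers `1`
iff the average label of the `k` sample points nearest to `x` exceeds `1/2`. -/
def knn {d n : ℕ} (k : ℕ) (S : Fin n → EuclideanSpace ℝ (Fin d) × Bool)
    (x : EuclideanSpace ℝ (Fin d)) : Bool :=
  decide ((1 / 2 : ℝ) <
    (1 / (k : ℝ)) * ∑ j : Fin n with j.val < k, (if (S (order S x j)).2 then (1 : ℝ) else 0))

/-- The risk `P(Φ(X) ≠ Y)` of a (possibly sample-dependent) classifier `Φ`, the probability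
being over the i.i.d. sample of size `n` and an independent pair `(X, Y)`, all of law
`modelLaw θ μ`. -/
def risk {d n : ℕ} (θ μ : EuclideanSpace ℝ (Fin d))
    (Φ : (Fin n → EuclideanSpace ℝ (Fin d) × Bool) → EuclideanSpace ℝ (Fin d) → Bool) : ℝ :=
  ((Measure.pi (fun _ : Fin n => modelLaw θ μ)).prod (modelLaw θ μ)).real
    {ω | Φ ω.1 ω.2.1 ≠ ω.2.2}

/-- The range `K_n` of numbers of neighbours, in dimension `d`. -/
def neighbourRange (d n : ℕ) : Set ℕ :=
  {l | 1 ≤ l ∧ l ≤ n ∧ (d : ℝ) * ((l : ℝ) / (n : ℝ)) ^ (2 / (d : ℝ)) ≤ 1 / √(l : ℝ)}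

end

end GaussianKNN

/-! The excess risk is half the integral of `γ(x - θ) - γ(x - μ)` times the difference of the
probabilities that the two classifiers answer `0` at `x` (`risk_sub_risk`). Against the Bayes
classifier this integrand is nonnegative, so it is enough to bound it below on the strip where the
log-likelihood ratio `s(x)` lies in `[ε/2, ε]`, with `ε = 1/(2√k)`. There the gap between the
densities is at least `ε/2` times `γ(x - μ)`. The strip has mass of order `ε` under `N(μ, I_d)`:
this is a one-dimensional Gaussian probability, governed by `‖θ - μ‖` alone, whatever `d` is.
Finally, on the strip the nearest neighbours err with probability at least `1/8`. The product has
order `ε² = 1/(4k)`.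

The bound `1/8` has two sources. Once the points outside a set `J` of `k` indices are frozen, `J` is
the nearest set exactly when its points, still independent, all fall in a certain ball centred at
`x`. Reflecting that ball in the hyperplane through `x` parallel to the decision boundary shows that
the ratio of its `μ`-mass to its `θ`-mass is at least `exp(-s(x))`, whatever its radius
(`exp_neg_score_mul_gaussianAt_le`). The labels in the ball thus favour `1` by at most `s(x)`, a
bias no larger than the random fluctuation of an average of `k` labels, and a comparison with fair
labels leaves a fixed chance of no strict majority (`pow_le_eight_mul_sum_noMajority`). -/

namespace GaussianKNN

open scoped RealInnerProductSpace ENNReal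

/-! ### Lebesgue density of the Gaussian laws -/

section Density

variable {d : ℕ}

lemma gaussianDensity_pos (x : EuclideanSpace ℝ (Fin d)) : 0 < gaussianDensity x := by
  unfold gaussianDensity; positivity

@[fun_prop]
lemma continuous_gaussianDensity :
    Continuous (gaussianDensity : EuclideanSpace ℝ (Fin d) → ℝ) := by
  unfold gaussianDensity; fun_prop

lemma integrable_gaussianDensity :
    Integrable (gaussianDensity : EuclideanSpace ℝ (Fin d) → ℝ) := by
  unfold gaussianDensity
  apply Integrable.const_mul
  have h := (GaussianFourier.integrable_cexp_neg_mul_sq_norm_add (V := EuclideanSpace ℝ (Fin d))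
    (b := 1 / 2) (by norm_num) 0 0).norm
  refine h.congr (ae_of_all _ fun x => ?_)
  simp only [Complex.norm_exp]
  norm_num [← Complex.ofReal_pow]
  ring

lemma charFun_withDensity_gaussianDensity (t : EuclideanSpace ℝ (Fin d)) :
    charFun (volume.withDensity
      fun x : EuclideanSpace ℝ (Fin d) => ENNReal.ofReal (gaussianDensity x)) t =
      Complex.exp (-‖t‖ ^ 2 / 2) := by
  rw [charFun_apply, integral_withDensity_eq_integral_toReal_smul (by fun_prop) (by simp)]
  have h := GaussianFourier.integral_cexp_neg_mul_sq_norm_add (V := EuclideanSpace ℝ (Fin d))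
    (b := 1 / 2) (by norm_num) Complex.I t
  have h2 : ∀ x : EuclideanSpace ℝ (Fin d),
      (ENNReal.ofReal (gaussianDensity x)).toReal • Complex.exp (⟪x, t⟫ * Complex.I) =
      ((2 * Real.pi : ℝ) ^ (-(d : ℝ) / 2) : ℝ) *
        Complex.exp (-(1 / 2) * ‖x‖ ^ 2 + Complex.I * ⟪t, x⟫) := by
    intro x
    rw [ENNReal.toReal_ofReal (gaussianDensity_pos x).le, gaussianDensity, Complex.exp_add,
      real_inner_comm, Complex.real_smul]
    push_cast
    rw [mul_assoc, mul_comm Complex.I]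
    congr 4
    ring
  simp_rw [h2]
  rw [integral_const_mul, h, ← mul_assoc]
  have h3 : (((2 * Real.pi : ℝ) ^ (-(d : ℝ) / 2) : ℝ) : ℂ) *
      ((Real.pi : ℂ) / (1 / 2)) ^ ((Module.finrank ℝ (EuclideanSpace ℝ (Fin d)) : ℂ) / 2) = 1 := by
    have e1 : ((Real.pi : ℂ) / (1 / 2)) = ((2 * Real.pi : ℝ) : ℂ) := by push_cast; ring
    have e2 : ((Module.finrank ℝ (EuclideanSpace ℝ (Fin d)) : ℂ) / 2) =
        (((d : ℝ) / 2 : ℝ) : ℂ) := by simp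
    rw [e1, e2, ← Complex.ofReal_cpow (by positivity), ← Complex.ofReal_mul,
      ← Real.rpow_add (by positivity)]
    rw [neg_div, neg_add_cancel, Real.rpow_zero, Complex.ofReal_one]
  rw [h3, one_mul]
  congr 1
  simp only [Complex.I_sq]
  ring

/-- Finite measures with the same characteristic function coincide. -/
theorem stdGaussian_eq_withDensity :
    stdGaussian (EuclideanSpace ℝ (Fin d)) =
      volume.withDensity fun x => ENNReal.ofReal (gaussianDensity x) := by
  have : IsFiniteMeasure (volume.withDensity
      fun x : EuclideanSpace ℝ (Fin d) => ENNReal.ofReal (gaussianDensity x)) :=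
    isFiniteMeasure_withDensity_ofReal integrable_gaussianDensity.2
  apply Measure.ext_of_charFun
  ext t
  rw [charFun_withDensity_gaussianDensity, charFun_stdGaussian]

theorem gaussianAt_eq_withDensity (a : EuclideanSpace ℝ (Fin d)) :
    gaussianAt a = volume.withDensity fun x => ENNReal.ofReal (gaussianDensity (x - a)) := by
  ext s hs
  rw [gaussianAt, stdGaussian_eq_withDensity, Measure.map_apply (by fun_prop) hs,
    withDensity_apply _ hs, withDensity_apply _ (hs.preimage (by fun_prop)),
    ← (measurePreserving_add_left volume a).setLIntegral_comp_preimage hs (by fun_prop)]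
  simp

lemma integrable_gaussianDensity_sub (a : EuclideanSpace ℝ (Fin d)) :
    Integrable fun x => gaussianDensity (x - a) :=
  integrable_gaussianDensity.comp_sub_right a

lemma integral_gaussianAt (a : EuclideanSpace ℝ (Fin d)) (f : EuclideanSpace ℝ (Fin d) → ℝ) :
    ∫ x, f x ∂gaussianAt a = ∫ x, gaussianDensity (x - a) * f x := by
  rw [gaussianAt_eq_withDensity,
    integral_withDensity_eq_integral_toReal_smul (by fun_prop) (by simp)]
  simp [ENNReal.toReal_ofReal (gaussianDensity_pos _).le]

end Density

/-! ### Log-likelihood ratio and reflection symmetrization -/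

section Score

variable {d : ℕ}

/-- The log-likelihood ratio of `N(θ, I_d)` against `N(μ, I_d)`. -/
noncomputable def score (θ μ x : EuclideanSpace ℝ (Fin d)) : ℝ :=
  ⟪x - (2⁻¹ : ℝ) • (θ + μ), θ - μ⟫

@[fun_prop]
lemma continuous_score (θ μ : EuclideanSpace ℝ (Fin d)) : Continuous (score θ μ) := by
  unfold score; fun_prop

/-- The covariances agree, so the quadratic terms in `x` cancel and the log-ratio is affine. -/
lemma gaussianDensity_sub_eq (θ μ x : EuclideanSpace ℝ (Fin d)) :
    gaussianDensity (x - θ) = Real.exp (score θ μ x) * gaussianDensity (x - μ) := by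
  unfold gaussianDensity score
  rw [mul_left_comm, ← Real.exp_add]
  congr 2
  simp only [← real_inner_self_eq_norm_sq, inner_sub_left, inner_sub_right, inner_add_left,
    inner_smul_left, real_inner_comm]
  simp
  ring

lemma score_add_right (θ μ x v : EuclideanSpace ℝ (Fin d)) :
    score θ μ (x + v) = score θ μ x + ⟪θ - μ, v⟫ := by
  unfold score
  rw [add_sub_right_comm, inner_add_left, real_inner_comm v]

lemma regression_ge_half_iff (θ μ x : EuclideanSpace ℝ (Fin d)) :
    1 / 2 ≤ regression θ μ x ↔ 0 ≤ score θ μ x := by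
  have h := gaussianDensity_pos (x - μ)
  have h' := gaussianDensity_pos (x - θ)
  rw [regression, div_le_div_iff₀ (by norm_num) (by positivity),
    ← Real.one_le_exp_iff, gaussianDensity_sub_eq θ μ x]
  constructor
  · intro h2
    by_contra! h3
    nlinarith
  · intro h2
    nlinarith

lemma bayes_eq_false_iff (θ μ x : EuclideanSpace ℝ (Fin d)) :
    bayes θ μ x = false ↔ score θ μ x < 0 := by
  simp only [bayes, decide_eq_false_iff_not, regression_ge_half_iff, not_le]

/-- After symmetrization in the hyperplane through `x` parallel to the decision boundary, the two
densities around `x` compare pointwise. -/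
lemma exp_neg_score_mul_density_add_le (θ μ x v : EuclideanSpace ℝ (Fin d))
    (hx : 0 ≤ score θ μ x) :
    Real.exp (-score θ μ x) * (gaussianDensity (x + v - θ) +
        gaussianDensity (x + (ℝ ∙ (θ - μ))ᗮ.reflection v - θ)) ≤
      gaussianDensity (x + v - μ) +
        gaussianDensity (x + (ℝ ∙ (θ - μ))ᗮ.reflection v - μ) := by
  set D := θ - μ with hD
  set R := (ℝ ∙ D)ᗮ.reflection
  rcases eq_or_ne D 0 with h0 | h0
  · have : θ = μ := by rwa [hD, sub_eq_zero] at h0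
    subst this
    simp [score]
  have hDpos : 0 < ‖D‖ ^ 2 := by positivity
  have hR : R v = v - (2 * (⟪D, v⟫ / ‖D‖ ^ 2)) • D := by
    simp only [R, Submodule.reflection_orthogonal_apply, Submodule.reflection_singleton_apply]
    simp [two_smul, two_mul, add_smul]
  set A := ⟪D, v⟫ with hA
  have hRA : ⟪D, R v⟫ = -A := by
    rw [hR, inner_sub_right, inner_smul_right, real_inner_self_eq_norm_sq]
    field_simp
    ring
  set m := (2⁻¹ : ℝ) • (θ + μ) with hm
  set p := x - m with hp
  set c := score θ μ x / ‖D‖ ^ 2 with hc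
  have hscore : score θ μ x = c * ‖D‖ ^ 2 := by rw [hc]; field_simp
  have hpD : ⟪p, D⟫ = c * ‖D‖ ^ 2 := hscore
  have hc0 : 0 ≤ c := by positivity
  have hpR : ⟪p, R v⟫ = ⟪p, v⟫ - 2 * c * A := by
    rw [hR, inner_sub_right, inner_smul_right, hpD]
    field_simp
  have hnR : ‖R v‖ = ‖v‖ := R.norm_map v
  -- The common factor of the four densities. The term `-⟪p, v⟫ + c * A` is the mean of `-⟪p, v⟫`
  -- and `-⟪p, R v⟫`, so that each pair leaves opposite exponents in `A` and sums to a hyperbolic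
  -- cosine.
  set K := (2 * Real.pi) ^ (-(d : ℝ) / 2) *
    Real.exp (-(‖p‖ ^ 2 + ‖v‖ ^ 2 + ‖D‖ ^ 2 / 4) / 2 - ⟪p, v⟫ + c * A) with hK
  have hK0 : 0 < K := by positivity
  have key : ∀ (w a : EuclideanSpace ℝ (Fin d)) (s : ℝ), a = m + (s / 2) • D → s ^ 2 = 1 →
      ‖w‖ = ‖v‖ → gaussianDensity (x + w - a) =
        K * Real.exp (⟪p, v⟫ - ⟪p, w⟫ - c * A + s / 2 * (c * ‖D‖ ^ 2 + ⟪D, w⟫)) := by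
    intro w a s ha hs hw
    have : x + w - a = p + w - (s / 2) • D := by rw [ha, hp]; abel
    rw [gaussianDensity, this, hK, mul_assoc, ← Real.exp_add]
    congr 2
    rw [norm_sub_sq_real, norm_add_sq_real, inner_smul_right, inner_add_left, hpD, norm_smul,
      mul_pow, hw, real_inner_comm D w, Real.norm_eq_abs, sq_abs]
    have : (s / 2) ^ 2 = 1 / 4 := by rw [div_pow, hs]; norm_num
    rw [this]
    ring
  have hθ : θ = m + ((1 : ℝ) / 2) • D := by rw [hm, hD]; module
  have hμ : μ = m + ((-1 : ℝ) / 2) • D := by rw [hm, hD]; module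
  rw [key v θ 1 hθ (by norm_num) rfl, key (R v) θ 1 hθ (by norm_num) hnR,
    key v μ (-1) hμ (by norm_num) rfl, key (R v) μ (-1) hμ (by norm_num) hnR, hpR, hRA, ← hA,
    hscore]
  -- The only use of the sign of the score: `c ≥ 0` gives `|1/2 - c| ≤ |1/2 + c|`.
  have hcosh : Real.cosh ((1 / 2 - c) * A) ≤ Real.cosh ((1 / 2 + c) * A) := by
    rw [Real.cosh_le_cosh, abs_mul, abs_mul]
    refine mul_le_mul_of_nonneg_right (sq_le_sq.1 ?_) (abs_nonneg A)
    nlinarith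
  have e1 : Real.exp (-(c * ‖D‖ ^ 2)) *
      (K * Real.exp (⟪p, v⟫ - ⟪p, v⟫ - c * A + 1 / 2 * (c * ‖D‖ ^ 2 + A)) +
      K * Real.exp (⟪p, v⟫ - (⟪p, v⟫ - 2 * c * A) - c * A + 1 / 2 * (c * ‖D‖ ^ 2 + -A))) =
      K * Real.exp (-(c * ‖D‖ ^ 2) / 2) * (2 * Real.cosh ((1 / 2 - c) * A)) := by
    have a1 : Real.exp (-(c * ‖D‖ ^ 2)) *
        Real.exp (⟪p, v⟫ - ⟪p, v⟫ - c * A + 1 / 2 * (c * ‖D‖ ^ 2 + A)) =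
        Real.exp (-(c * ‖D‖ ^ 2) / 2) * Real.exp ((1 / 2 - c) * A) := by
      rw [← Real.exp_add, ← Real.exp_add]; congr 1; ring
    have a2 : Real.exp (-(c * ‖D‖ ^ 2)) * Real.exp
        (⟪p, v⟫ - (⟪p, v⟫ - 2 * c * A) - c * A + 1 / 2 * (c * ‖D‖ ^ 2 + -A)) =
        Real.exp (-(c * ‖D‖ ^ 2) / 2) * Real.exp (-((1 / 2 - c) * A)) := by
      rw [← Real.exp_add, ← Real.exp_add]; congr 1; ring
    rw [Real.cosh_eq]
    linear_combination K * a1 + K * a2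
  have e2 : (K * Real.exp (⟪p, v⟫ - ⟪p, v⟫ - c * A + -1 / 2 * (c * ‖D‖ ^ 2 + A)) +
      K * Real.exp (⟪p, v⟫ - (⟪p, v⟫ - 2 * c * A) - c * A + -1 / 2 * (c * ‖D‖ ^ 2 + -A))) =
      K * Real.exp (-(c * ‖D‖ ^ 2) / 2) * (2 * Real.cosh ((1 / 2 + c) * A)) := by
    have a1 : Real.exp (⟪p, v⟫ - ⟪p, v⟫ - c * A + -1 / 2 * (c * ‖D‖ ^ 2 + A)) =
        Real.exp (-(c * ‖D‖ ^ 2) / 2) * Real.exp (-((1 / 2 + c) * A)) := by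
      rw [← Real.exp_add]; congr 1; ring
    have a2 : Real.exp
        (⟪p, v⟫ - (⟪p, v⟫ - 2 * c * A) - c * A + -1 / 2 * (c * ‖D‖ ^ 2 + -A)) =
        Real.exp (-(c * ‖D‖ ^ 2) / 2) * Real.exp ((1 / 2 + c) * A) := by
      rw [← Real.exp_add]; congr 1; ring
    rw [Real.cosh_eq]
    linear_combination K * a1 + K * a2
  rw [e1, e2]
  gcongr

/-- On a set described by the distance to `x`, the mass of `N(μ, I_d)` is at least that of
`N(θ, I_d)`, up to the likelihood ratio at `x`. -/
theorem exp_neg_score_mul_gaussianAt_le (θ μ x : EuclideanSpace ℝ (Fin d))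
    (hx : 0 ≤ score θ μ x) {T : Set ℝ} (hT : MeasurableSet T) :
    ENNReal.ofReal (Real.exp (-score θ μ x)) * gaussianAt θ ((fun z => ‖z - x‖) ⁻¹' T) ≤
      gaussianAt μ ((fun z => ‖z - x‖) ⁻¹' T) := by
  set R := (ℝ ∙ (θ - μ))ᗮ.reflection
  set C : Set (EuclideanSpace ℝ (Fin d)) := (fun z => ‖z‖) ⁻¹' T
  have hC : MeasurableSet C := hT.preimage (by fun_prop)
  have hRC : R ⁻¹' C = C := by ext v; simp [C]
  -- `R` preserves both the norm and Lebesgue measure, so the integral over `C` may be averaged over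
  -- `v` and `R v`.
  have hsym : ∀ a : EuclideanSpace ℝ (Fin d),
      2 * gaussianAt a ((fun z => ‖z - x‖) ⁻¹' T) =
        ∫⁻ v in C, ENNReal.ofReal (gaussianDensity (x + v - a) +
          gaussianDensity (x + R v - a)) := by
    intro a
    have hB : MeasurableSet ((fun z : EuclideanSpace ℝ (Fin d) => ‖z - x‖) ⁻¹' T) :=
      hT.preimage (by fun_prop)
    have h1 : gaussianAt a ((fun z => ‖z - x‖) ⁻¹' T) =
        ∫⁻ v in C, ENNReal.ofReal (gaussianDensity (x + v - a)) := by
      rw [gaussianAt_eq_withDensity, withDensity_apply _ hB,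
        ← (measurePreserving_add_left volume x).setLIntegral_comp_preimage hB (by fun_prop)]
      congr 2
      ext v
      simp [C]
    have h2 : ∫⁻ v in C, ENNReal.ofReal (gaussianDensity (x + v - a)) =
        ∫⁻ v in C, ENNReal.ofReal (gaussianDensity (x + R v - a)) := by
      rw [← R.measurePreserving.setLIntegral_comp_preimage hC (by fun_prop), hRC]
    simp_rw [ENNReal.ofReal_add (gaussianDensity_pos _).le (gaussianDensity_pos _).le]
    rw [lintegral_add_left (by fun_prop), ← h2, ← h1, two_mul]
  rw [← ENNReal.mul_le_mul_iff_right (a := 2) (by norm_num) (by norm_num), mul_left_comm,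
    hsym, hsym, ← lintegral_const_mul _ (by fun_prop)]
  refine lintegral_mono fun v => ?_
  rw [← ENNReal.ofReal_mul (Real.exp_pos _).le]
  exact ENNReal.ofReal_le_ofReal (exp_neg_score_mul_density_add_le θ μ x v hx)

end Score

/-! ### Probability that slightly biased labels give no strict majority -/

section MinorityVote

variable {ι : Type*} [Fintype ι]

lemma card_true_add_card_false (y : ι → Bool) :
    (Finset.univ.filter fun j => y j = true).card +
      (Finset.univ.filter fun j => y j = false).card = Fintype.card ι := by
  simpa using Finset.card_filter_add_card_filter_not (s := Finset.univ) (fun j => y j = true)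

lemma prod_label_eq (w : Bool → ℝ) (y : ι → Bool) :
    ∏ j, w (y j) = w true ^ (Finset.univ.filter fun j => y j = true).card *
      w false ^ (Finset.univ.filter fun j => y j = false).card := by
  rw [← Finset.prod_filter_mul_prod_filter_not Finset.univ (fun j => y j = true)]
  congr 1
  · rw [Finset.prod_congr rfl (g := fun _ => w true), Finset.prod_const]
    simp +contextual
  · rw [Finset.prod_congr rfl (g := fun _ => w false), Finset.prod_const]
    · simp
    · simp +contextual

variable [DecidableEq ι]

/-- The label patterns in which `true` has no strict majority. -/
def noMajority (ι : Type*) [Fintype ι] [DecidableEq ι] : Finset (ι → Bool) :=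
  Finset.univ.filter fun y => 2 * (Finset.univ.filter fun j => y j = true).card ≤ Fintype.card ι

lemma mem_noMajority {y : ι → Bool} : y ∈ noMajority ι ↔
    2 * (Finset.univ.filter fun j => y j = true).card ≤ Fintype.card ι := by
  simp [noMajority]

/-- Flipping all labels sends a strict majority of `true` into `noMajority`. Balanced patterns are
counted twice, whence an inequality. -/
lemma sum_le_sum_noMajority_add_flip (f : (ι → Bool) → ℝ) (hf : ∀ y, 0 ≤ f y) :
    ∑ y, f y ≤ ∑ y ∈ noMajority ι, f y + ∑ y ∈ noMajority ι, f fun j => !y j := by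
  rw [← Finset.sum_add_sum_compl (noMajority ι) f]
  gcongr
  have hinj : Set.InjOn (fun (y : ι → Bool) j => !y j) (noMajority ι : Set (ι → Bool)) := by
    intro y _ z _ h
    ext j
    simpa using congrFun h j
  rw [← Finset.sum_image (f := f) (g := fun (y : ι → Bool) j => !y j) hinj]
  refine Finset.sum_le_sum_of_subset_of_nonneg (fun y hy => ?_) fun y _ _ => hf y
  refine Finset.mem_image.2 ⟨fun j => !y j, ?_, by simp⟩
  rw [Finset.mem_compl, mem_noMajority] at hy
  rw [mem_noMajority]
  have := card_true_add_card_false y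
  simp only [Bool.not_eq_eq_eq_not, Bool.not_true] at *
  omega

lemma sum_prod_label (w : Bool → ℝ) :
    ∑ y : ι → Bool, ∏ j, w (y j) = (w true + w false) ^ Fintype.card ι := by
  have := Finset.prod_univ_sum (fun _ : ι => (Finset.univ : Finset Bool)) (fun _ b => w b)
  rw [Fintype.piFinset_univ] at this
  rw [← this]
  simp

/-- If `true` is not favoured, it has no strict majority with probability at least `1 / 2`. -/
lemma pow_le_two_mul_sum_noMajority (w : Bool → ℝ) (hw : ∀ b, 0 ≤ w b)
    (h : w true ≤ w false) :
    (w true + w false) ^ Fintype.card ι ≤ 2 * ∑ y ∈ noMajority ι, ∏ j, w (y j) := by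
  rw [← sum_prod_label (ι := ι), two_mul]
  refine (sum_le_sum_noMajority_add_flip _ fun y => Finset.prod_nonneg fun j _ => hw _).trans ?_
  gcongr ?_ + ?_
  · exact le_rfl
  refine Finset.sum_le_sum fun y hy => ?_
  rw [prod_label_eq, prod_label_eq]
  rw [mem_noMajority] at hy
  have hc := card_true_add_card_false y
  simp only [Bool.not_eq_eq_eq_not, Bool.not_true, Bool.not_false]
  set t := (Finset.univ.filter fun j => y j = true).card
  set f := (Finset.univ.filter fun j => y j = false).card
  -- Flipping exchanges the exponents `t ≤ f`, so it multiplies the weight by `(w true / w false) ^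
  -- r`, at most `1`; the argument avoids the division.
  obtain ⟨r, hr⟩ : ∃ r, f = t + r := ⟨f - t, by omega⟩
  have := pow_le_pow_left₀ (hw true) h r
  have h1 : 0 ≤ w true ^ t * w false ^ t := mul_nonneg (pow_nonneg (hw _) _) (pow_nonneg (hw _) _)
  rw [hr, pow_add, pow_add]
  nlinarith

/-- A change of measure from fair labels, by the Cauchy-Schwarz inequality. -/
lemma pow_le_four_mul_sum_noMajority (w : Bool → ℝ) (hw : ∀ b, 0 < w b) :
    (4 * w true * w false / (w true + w false)) ^ Fintype.card ι ≤
      4 * ∑ y ∈ noMajority ι, ∏ j, w (y j) := by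
  set k := Fintype.card ι
  have hcard : (2 : ℝ) ^ k ≤ 2 * ∑ y ∈ noMajority ι, (1 : ℝ) := by
    have := sum_le_sum_noMajority_add_flip (ι := ι) (fun _ => (1 : ℝ)) (fun _ => zero_le_one)
    simp only [Finset.sum_const, Finset.card_univ, Fintype.card_fun, Fintype.card_bool] at this ⊢
    simp only [nsmul_eq_mul, mul_one] at this ⊢
    push_cast at this
    linarith
  have hpos : ∀ y : ι → Bool, 0 < ∏ j, w (y j) := fun y => Finset.prod_pos fun j _ => hw _
  -- Cauchy-Schwarz for `1 = √W * √W⁻¹`, where `W` is the weight of a pattern; `hcard` says that at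
  -- least half of the patterns lie in `noMajority`.
  have hcs : (∑ y ∈ noMajority ι, (1 : ℝ)) ^ 2 ≤
      (∑ y ∈ noMajority ι, ∏ j, w (y j)) * ∑ y ∈ noMajority ι, ∏ j, (w (y j))⁻¹ := by
    refine Finset.sum_sq_le_sum_mul_sum_of_sq_le_mul _ (fun y _ => (hpos y).le)
      (fun y _ => Finset.prod_nonneg fun j _ => (inv_pos.2 (hw _)).le) fun y _ => ?_
    rw [Finset.prod_inv_distrib, mul_inv_cancel₀ (hpos y).ne', one_pow]
  have hinv : ∑ y ∈ noMajority ι, ∏ j, (w (y j))⁻¹ ≤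
      ((w true + w false) / (w true * w false)) ^ k := by
    have h1 := hw true
    have h2 := hw false
    have : (w true + w false) / (w true * w false) = (w true)⁻¹ + (w false)⁻¹ := by
      field_simp
      ring
    rw [this, ← sum_prod_label (ι := ι) fun b => (w b)⁻¹]
    exact Finset.sum_le_univ_sum_of_nonneg fun y =>
      Finset.prod_nonneg fun j _ => (inv_pos.2 (hw _)).le
  have h1 := hw true
  have h2 := hw false
  have hs : 0 ≤ ∑ y ∈ noMajority ι, ∏ j, w (y j) := Finset.sum_nonneg fun y _ => (hpos y).le
  have e : (4 * w true * w false / (w true + w false)) ^ k *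
      ((w true + w false) / (w true * w false)) ^ k = (2 ^ k) ^ 2 := by
    rw [← mul_pow, ← pow_mul, mul_comm k, pow_mul]
    congr 1
    field_simp
    norm_num
  have hq : 0 < ((w true + w false) / (w true * w false)) ^ k := by positivity
  rw [← mul_le_mul_iff_left₀ hq, e]
  calc ((2 : ℝ) ^ k) ^ 2 ≤ (2 * ∑ y ∈ noMajority ι, (1 : ℝ)) ^ 2 := by gcongr
    _ = 4 * (∑ y ∈ noMajority ι, (1 : ℝ)) ^ 2 := by ring
    _ ≤ 4 * ((∑ y ∈ noMajority ι, ∏ j, w (y j)) *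
        ((w true + w false) / (w true * w false)) ^ k) := by
      gcongr
      exact hcs.trans (mul_le_mul_of_nonneg_left hinv hs)
    _ = _ := by ring

/-- With relative bias `D`, the Cauchy-Schwarz bound loses a factor `(1 - D²)^k`, which stays above
`1/2` while `k * D² ≤ 1/2`. The weights are not normalized, so no conditional law is needed and a
null ball is allowed. -/
theorem pow_le_eight_mul_sum_noMajority (w : Bool → ℝ) (hw : ∀ b, 0 ≤ w b) {s : ℝ}
    (hs : 2 * Fintype.card ι * s ^ 2 ≤ 1) (hs0 : 0 ≤ s)
    (h : Real.exp (-s) * w true ≤ w false) :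
    (w true + w false) ^ Fintype.card ι ≤ 8 * ∑ y ∈ noMajority ι, ∏ j, w (y j) := by
  have hnn : 0 ≤ ∑ y ∈ noMajority ι, ∏ j, w (y j) :=
    Finset.sum_nonneg fun y _ => Finset.prod_nonneg fun j _ => hw _
  -- The first case absorbs vanishing weights; in the second both are positive, as the change of
  -- measure requires.
  rcases le_or_gt (w true) (w false) with hle | hlt
  · exact (pow_le_two_mul_sum_noMajority w hw hle).trans (by linarith)
  have ht : 0 < w true := (hw false).trans_lt hlt
  have hf : 0 < w false := (mul_pos (Real.exp_pos _) ht).trans_le h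
  have h4 := pow_le_four_mul_sum_noMajority (ι := ι) w (by simp [ht, hf])
  set k := Fintype.card ι
  set m := w true + w false with hm
  have hmpos : 0 < m := by positivity
  set D := (w true - w false) / m with hD
  have hD0 : 0 ≤ D := div_nonneg (by linarith) hmpos.le
  -- From `1 - s ≤ exp (-s)`: `w true - w false ≤ s * w true ≤ s * m`.
  have hDs : D ≤ s := by
    rw [hD, div_le_iff₀ hmpos]
    have := Real.add_one_le_exp (-s)
    nlinarith
  have e : 4 * w true * w false / m = m * (1 - D ^ 2) := by
    rw [hD, hm]
    field_simp
    ring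
  have hD1 : D ≤ 1 := by
    rw [hD, div_le_one hmpos]
    linarith
  have hbern : 1 + (k : ℝ) * (-D ^ 2) ≤ (1 + (-D ^ 2)) ^ k :=
    one_add_mul_le_pow (by nlinarith) k
  have hk : (k : ℝ) * D ^ 2 ≤ 1 / 2 := by
    have : (k : ℝ) * D ^ 2 ≤ k * s ^ 2 := by gcongr
    linarith
  rw [e, mul_pow, sub_eq_add_neg] at h4
  have hhalf : (1 / 2 : ℝ) ≤ (1 + (-D ^ 2)) ^ k := by linarith
  have hmk : 0 < m ^ k := by positivity
  nlinarith

end MinorityVote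

/-! ### Product measures and independent labelled points -/

section Product

variable {α : Type*} [MeasurableSpace α]

lemma measurableSet_mem_of_finite {ι : Type*} [Finite ι] {f : α → ι → Bool} (hf : Measurable f)
    (A : Set (ι → Bool)) : MeasurableSet {a | f a ∈ A} :=
  hf (Set.toFinite A).measurableSet

/-- Independent labelled points that fall in `B`, where the label `true` is only slightly favoured,
have no strict majority of labels `true` with probability at least `1 / 8`. -/
theorem pow_le_eight_mul_pi_noMajority {ι : Type*} [Fintype ι] [DecidableEq ι]
    (P : Measure (α × Bool)) [IsProbabilityMeasure P] {B : Set α} (hB : MeasurableSet B) {s : ℝ}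
    (hs0 : 0 ≤ s) (hs : 2 * Fintype.card ι * s ^ 2 ≤ 1)
    (h : ENNReal.ofReal (Real.exp (-s)) * P (B ×ˢ {true}) ≤ P (B ×ˢ {false})) :
    P (B ×ˢ Set.univ) ^ Fintype.card ι ≤ 8 * Measure.pi (fun _ : ι => P)
      {S | (∀ j, (S j).1 ∈ B) ∧ (fun j => (S j).2) ∈ noMajority ι} := by
  set w : Bool → ℝ := fun b => P.real (B ×ˢ {b}) with hw
  have hw' : ∀ b, P (B ×ˢ {b}) = ENNReal.ofReal (w b) := fun b => by
    rw [hw, ofReal_measureReal]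
  have hw0 : ∀ b, 0 ≤ w b := fun b => measureReal_nonneg
  have hset : {S : ι → α × Bool | (∀ j, (S j).1 ∈ B) ∧ (fun j => (S j).2) ∈ noMajority ι} =
      ⋃ y ∈ noMajority ι, Set.univ.pi fun j => B ×ˢ {y j} := by
    ext S
    simp only [Set.mem_ofPred_eq, Set.mem_iUnion, Set.mem_pi, Set.mem_univ, true_imp_iff,
      Set.mem_prod, Set.mem_singleton_iff, exists_prop]
    constructor
    · rintro ⟨h1, h2⟩
      exact ⟨_, h2, fun j => ⟨h1 j, rfl⟩⟩
    · rintro ⟨y, hy, h1⟩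
      have : (fun j => (S j).2) = y := funext fun j => (h1 j).2
      exact ⟨fun j => (h1 j).1, this ▸ hy⟩
  have hdisj : Set.PairwiseDisjoint (noMajority ι : Set (ι → Bool))
      fun y => Set.univ.pi fun j => B ×ˢ ({y j} : Set Bool) := by
    intro y _ z _ hyz
    rw [Function.onFun, Set.disjoint_left]
    intro S hy hz
    apply hyz
    ext j
    have h1 := (hy j trivial).2
    have h2 := (hz j trivial).2
    simp only [Set.mem_singleton_iff] at h1 h2
    rw [← h1, ← h2]
  have htot : P (B ×ˢ Set.univ) = ENNReal.ofReal (w true + w false) := by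
    have : B ×ˢ (Set.univ : Set Bool) = B ×ˢ {true} ∪ B ×ˢ {false} := by
      rw [← Set.prod_union]
      congr 1
      ext b
      cases b <;> simp
    rw [this, measure_union _ (hB.prod (measurableSet_singleton _)), hw', hw',
      ENNReal.ofReal_add (hw0 _) (hw0 _)]
    exact Set.Disjoint.set_prod_right (by simp) _ _
  have hreal : Real.exp (-s) * w true ≤ w false := by
    rw [hw', hw', ← ENNReal.ofReal_mul (Real.exp_pos _).le] at h
    exact (ENNReal.ofReal_le_ofReal_iff (hw0 _)).1 h
  rw [hset, measure_biUnion_finset hdisj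
    fun y _ => MeasurableSet.univ_pi fun j => hB.prod (measurableSet_singleton _), htot]
  simp_rw [Measure.pi_pi, hw', ← ENNReal.ofReal_prod_of_nonneg fun j _ => hw0 _]
  rw [← ENNReal.ofReal_sum_of_nonneg fun y _ => Finset.prod_nonneg fun j _ => hw0 _,
    ← ENNReal.ofReal_pow (add_nonneg (hw0 _) (hw0 _)),
    show (8 : ℝ≥0∞) = ENNReal.ofReal 8 by simp, ← ENNReal.ofReal_mul (by norm_num)]
  exact ENNReal.ofReal_le_ofReal (pow_le_eight_mul_sum_noMajority w hw0 hs hs0 hreal)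

/-- Tonelli with the coordinates outside `p` frozen; it replaces conditioning on the far points. -/
lemma pi_apply_eq_lintegral {ι : Type*} [Fintype ι] (P : Measure α) [IsProbabilityMeasure P]
    (p : ι → Prop) [DecidablePred p] {M : Set (ι → α)} (hM : MeasurableSet M) :
    Measure.pi (fun _ : ι => P) M =
      ∫⁻ t : {i // ¬ p i} → α, Measure.pi (fun _ : {i // p i} => P)
        {s | (fun i => if h : p i then s ⟨i, h⟩ else t ⟨i, h⟩) ∈ M}
        ∂Measure.pi (fun _ => P) := by
  have h := (measurePreserving_piEquivPiSubtypeProd (fun _ : ι => P) p).symm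
  rw [← h.measure_preimage hM.nullMeasurableSet,
    Measure.prod_apply_symm (h.measurable hM)]
  rfl

end Product

/-! ### The set of nearest points and the vote -/

section Nearest

variable {d n : ℕ}

/-- The event that the points with index in `J` are the nearest ones to `x`. -/
def nearestEvent (x : EuclideanSpace ℝ (Fin d)) (J : Finset (Fin n)) :
    Set (Fin n → EuclideanSpace ℝ (Fin d) × Bool) :=
  {S | ∀ j ∈ J, ∀ l ∉ J, ‖(S j).1 - x‖ < ‖(S l).1 - x‖}

/-- The event that the points with index in `J` have no strict majority of labels `true`. -/
def minorityEvent (d : ℕ) (J : Finset (Fin n)) : Set (Fin n → EuclideanSpace ℝ (Fin d) × Bool) :=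
  {S | (fun j : {i // i ∈ J} => (S j).2) ∈ noMajority {i // i ∈ J}}

lemma measurableSet_nearestEvent (x : EuclideanSpace ℝ (Fin d)) (J : Finset (Fin n)) :
    MeasurableSet (nearestEvent x J) := by
  have : nearestEvent x J = ⋂ j ∈ J, ⋂ l ∈ Jᶜ,
      {S : Fin n → EuclideanSpace ℝ (Fin d) × Bool | ‖(S j).1 - x‖ < ‖(S l).1 - x‖} := by
    ext S; simp [nearestEvent]
  rw [this]
  exact Finset.measurableSet_biInter _ fun j _ => Finset.measurableSet_biInter _ fun l _ =>
    measurableSet_lt (by fun_prop) (by fun_prop)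

lemma measurableSet_minorityEvent (J : Finset (Fin n)) : MeasurableSet (minorityEvent d J) :=
  measurableSet_mem_of_finite
    (f := fun (S : Fin n → EuclideanSpace ℝ (Fin d) × Bool) (j : {i // i ∈ J}) => (S j).2)
    (by fun_prop) (noMajority {i // i ∈ J})

lemma modelLaw_prod_true (θ μ : EuclideanSpace ℝ (Fin d)) {B : Set (EuclideanSpace ℝ (Fin d))}
    (hB : MeasurableSet B) : modelLaw θ μ (B ×ˢ {true}) = 2⁻¹ * gaussianAt θ B := by
  have h := hB.prod (measurableSet_singleton true)
  simp [modelLaw, Measure.map_apply (by fun_prop : Measurable fun x => (x, true)) h,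
    Measure.map_apply (by fun_prop : Measurable fun x => (x, false)) h]

lemma modelLaw_prod_false (θ μ : EuclideanSpace ℝ (Fin d)) {B : Set (EuclideanSpace ℝ (Fin d))}
    (hB : MeasurableSet B) : modelLaw θ μ (B ×ˢ {false}) = 2⁻¹ * gaussianAt μ B := by
  have h := hB.prod (measurableSet_singleton false)
  simp [modelLaw, Measure.map_apply (by fun_prop : Measurable fun x => (x, true)) h,
    Measure.map_apply (by fun_prop : Measurable fun x => (x, false)) h]

/-- For frozen points outside `J`, the nearest event constrains each point of `J` separately to a
ball about `x`, so the bound for independent labels applies inside the integral. -/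
lemma pi_nearestEvent_le (θ μ x : EuclideanSpace ℝ (Fin d)) (hx : 0 ≤ score θ μ x)
    (J : Finset (Fin n)) (hJ : 2 * (J.card : ℝ) * score θ μ x ^ 2 ≤ 1) :
    Measure.pi (fun _ : Fin n => modelLaw θ μ) (nearestEvent x J) ≤
      8 * Measure.pi (fun _ : Fin n => modelLaw θ μ) (nearestEvent x J ∩ minorityEvent d J) := by
  rw [pi_apply_eq_lintegral _ (· ∈ J) (measurableSet_nearestEvent x J),
    pi_apply_eq_lintegral _ (· ∈ J)
      ((measurableSet_nearestEvent x J).inter (measurableSet_minorityEvent J)),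
    ← lintegral_const_mul' _ _ (by norm_num)]
  refine lintegral_mono fun t => ?_
  -- An intersection rather than a minimal radius, so that `J` may contain every index (then `T` is
  -- the whole line).
  set T : Set ℝ := ⋂ l : {i // i ∉ J}, Set.Iio ‖(t l).1 - x‖
  have hT : MeasurableSet T := MeasurableSet.iInter fun l => measurableSet_Iio
  set B := (fun z => ‖z - x‖) ⁻¹' T
  have hB : MeasurableSet B := hT.preimage (by fun_prop)
  have hmem : ∀ s : {i // i ∈ J} → EuclideanSpace ℝ (Fin d) × Bool,
      (fun i => if h : i ∈ J then s ⟨i, h⟩ else t ⟨i, h⟩) ∈ nearestEvent x J ↔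
        ∀ j, (s j).1 ∈ B := by
    intro s
    simp only [nearestEvent, Set.mem_ofPred_eq, B, T, Set.mem_preimage, Set.mem_iInter,
      Set.mem_Iio, Subtype.forall]
    refine forall₂_congr fun j hj => forall₂_congr fun l hl => ?_
    rw [dif_pos hj, dif_neg hl]
  have hmin : ∀ s : {i // i ∈ J} → EuclideanSpace ℝ (Fin d) × Bool,
      (fun i => if h : i ∈ J then s ⟨i, h⟩ else t ⟨i, h⟩) ∈ minorityEvent d J ↔
        (fun j => (s j).2) ∈ noMajority {i // i ∈ J} := by
    intro s
    simp [minorityEvent]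
  have hlaw : ENNReal.ofReal (Real.exp (-score θ μ x)) * modelLaw θ μ (B ×ˢ {true}) ≤
      modelLaw θ μ (B ×ˢ {false}) := by
    rw [modelLaw_prod_true θ μ hB, modelLaw_prod_false θ μ hB, mul_left_comm]
    gcongr
    exact exp_neg_score_mul_gaussianAt_le θ μ x hx hT
  have key := pow_le_eight_mul_pi_noMajority (ι := {i // i ∈ J}) (modelLaw θ μ) hB hx
    (by simpa using hJ) hlaw
  have e : {s : {i // i ∈ J} → EuclideanSpace ℝ (Fin d) × Bool | ∀ j, (s j).1 ∈ B} =
      Set.univ.pi fun _ => B ×ˢ Set.univ := by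
    ext s; simp [Set.mem_pi]
  simp only [Set.mem_inter_iff, hmem, hmin, e, Measure.pi_pi, Finset.prod_const,
    Finset.card_univ]
  convert key

/-- If an index outside `J` stood at a position `j < J.card`, all of `J`, being strictly nearer,
would occupy the `j` earlier positions, which are too few. -/
lemma image_order_eq (x : EuclideanSpace ℝ (Fin d)) {J : Finset (Fin n)}
    {S : Fin n → EuclideanSpace ℝ (Fin d) × Bool} (hS : S ∈ nearestEvent x J) :
    (Finset.univ.filter fun j : Fin n => j.val < J.card).map (order S x).toEmbedding = J := by
  have hmono : Monotone ((fun i => ‖(S i).1 - x‖) ∘ order S x) := Tuple.monotone_sort _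
  have hn : J.card ≤ n := by simpa using J.card_le_univ
  refine Finset.eq_of_subset_of_card_le (fun i hi => ?_) ?_
  · obtain ⟨j, hj, rfl⟩ := Finset.mem_map.1 hi
    simp only [Finset.mem_filter, Finset.mem_univ, true_and] at hj
    by_contra hnot
    have hsub : J ⊆ (Finset.Iio j).map (order S x).toEmbedding := by
      intro i hi
      refine Finset.mem_map.2 ⟨(order S x).symm i, ?_, by simp⟩
      rw [Finset.mem_Iio]
      by_contra! hle
      have h1 := hmono hle
      have h2 := hS i hi _ hnot
      simp only [Function.comp_apply, Equiv.apply_symm_apply] at h1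
      exact absurd h1 (not_le.2 h2)
    have := Finset.card_le_card hsub
    rw [Finset.card_map, Fin.card_Iio] at this
    omega
  · rw [Finset.card_map]
    have : (Finset.univ.filter fun j : Fin n => j.val < J.card).card = J.card := by
      rw [Fin.card_filter_val_lt, min_eq_right hn]
    exact this.ge

lemma knn_eq_false_iff (x : EuclideanSpace ℝ (Fin d)) {J : Finset (Fin n)} (hJ : 1 ≤ J.card)
    {S : Fin n → EuclideanSpace ℝ (Fin d) × Bool} (hS : S ∈ nearestEvent x J) :
    knn J.card S x = false ↔ S ∈ minorityEvent d J := by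
  have hsum : ∑ j : Fin n with j.val < J.card, (if (S (order S x j)).2 then (1 : ℝ) else 0) =
      ((Finset.univ.filter fun j : {i // i ∈ J} => (S j).2 = true).card : ℝ) := by
    have h1 := Finset.sum_map (Finset.univ.filter fun j : Fin n => j.val < J.card)
      (order S x).toEmbedding fun i => if (S i).2 then (1 : ℝ) else 0
    simp only [Equiv.coe_toEmbedding] at h1
    rw [← h1, image_order_eq x hS, ← Finset.sum_coe_sort J, Finset.sum_boole]
  rw [knn, decide_eq_false_iff_not, hsum, minorityEvent, Set.mem_ofPred_eq, mem_noMajority,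
    Fintype.card_coe, not_lt, one_div, inv_mul_le_iff₀ (by positivity)]
  rw [← @Nat.cast_le ℝ]
  push_cast
  constructor <;> intro h <;> linarith

lemma exists_mem_nearestEvent (x : EuclideanSpace ℝ (Fin d)) {k : ℕ} (hk : k ≤ n)
    {S : Fin n → EuclideanSpace ℝ (Fin d) × Bool}
    (hS : Function.Injective fun i => ‖(S i).1 - x‖) :
    ∃ J : Finset (Fin n), J.card = k ∧ S ∈ nearestEvent x J := by
  have hmono : Monotone ((fun i => ‖(S i).1 - x‖) ∘ order S x) := Tuple.monotone_sort _
  have hstrict := hmono.strictMono_of_injective (hS.comp (order S x).injective)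
  refine ⟨(Finset.univ.filter fun j : Fin n => j.val < k).map (order S x).toEmbedding, ?_, ?_⟩
  · rw [Finset.card_map, Fin.card_filter_val_lt, min_eq_right hk]
  · intro i hi l hl
    obtain ⟨j, hj, rfl⟩ := Finset.mem_map.1 hi
    obtain ⟨m, rfl⟩ := (order S x).surjective l
    have hm : ¬ m.val < k := fun h => hl (Finset.mem_map.2 ⟨m, by simpa using h, rfl⟩)
    have hj' : j.val < k := by simpa using hj
    exact hstrict (Fin.lt_def.2 (by omega))

lemma gaussianAt_sphere (hd : 1 ≤ d) (a x : EuclideanSpace ℝ (Fin d)) (r : ℝ) :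
    gaussianAt a {z | ‖z - x‖ = r} = 0 := by
  have : Nonempty (Fin d) := ⟨⟨0, hd⟩⟩
  rw [gaussianAt_eq_withDensity]
  apply withDensity_absolutelyContinuous
  have := Measure.addHaar_sphere (volume : Measure (EuclideanSpace ℝ (Fin d))) x r
  convert this using 2
  ext z
  simp

/-- With the other points frozen, a tie places one point on a sphere centred at `x`, which is null.
-/
lemma ae_injective_norm_sub (hd : 1 ≤ d) (θ μ x : EuclideanSpace ℝ (Fin d)) :
    ∀ᵐ S ∂Measure.pi (fun _ : Fin n => modelLaw θ μ),
      Function.Injective fun i => ‖(S i).1 - x‖ := by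
  have hpair : ∀ i l : Fin n, i ≠ l → ∀ᵐ S ∂Measure.pi (fun _ : Fin n => modelLaw θ μ),
      ‖(S i).1 - x‖ ≠ ‖(S l).1 - x‖ := by
    intro i l hil
    rw [ae_iff]
    simp only [ne_eq, not_not]
    rw [pi_apply_eq_lintegral _ (· = i) (measurableSet_eq_fun (by fun_prop) (by fun_prop))]
    refine (lintegral_congr fun t => ?_).trans lintegral_zero
    have hz : modelLaw θ μ ({z | ‖z - x‖ = ‖(t ⟨l, hil.symm⟩).1 - x‖} ×ˢ Set.univ) = 0 := by
      have hm : MeasurableSet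
          {z : EuclideanSpace ℝ (Fin d) | ‖z - x‖ = ‖(t ⟨l, hil.symm⟩).1 - x‖} :=
        measurableSet_eq_fun (by fun_prop) (by fun_prop)
      have : (Set.univ : Set Bool) = {true} ∪ {false} := by ext b; cases b <;> simp
      rw [this, Set.prod_union]
      refine measure_union_null ?_ ?_
      · rw [modelLaw_prod_true θ μ hm, gaussianAt_sphere hd, mul_zero]
      · rw [modelLaw_prod_false θ μ hm, gaussianAt_sphere hd, mul_zero]
    have := (measurePreserving_eval (fun _ : {j // j = i} => modelLaw θ μ)
      ⟨i, rfl⟩).quasiMeasurePreserving.preimage_null hz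
    refine measure_mono_null (t := Function.eval ⟨i, rfl⟩ ⁻¹'
      ({z | ‖z - x‖ = ‖(t ⟨l, hil.symm⟩).1 - x‖} ×ˢ Set.univ)) (fun s hs => ?_)
      (by convert this)
    simp only [Set.mem_ofPred_eq, dif_pos, dif_neg hil.symm] at hs
    simpa using hs
  simp only [Function.Injective]
  rw [ae_all_iff]
  intro i
  rw [ae_all_iff]
  intro l
  rcases eq_or_ne i l with rfl | h
  · simp
  · filter_upwards [hpair i l h] with S hS h'
    exact absurd h' hS

/-- Slightly inside the region where the Bayes classifier answers `1`, the nearest neighbours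
classifier answers `0` with probability at least `1 / 8`. -/
theorem one_le_eight_mul_pi_knn_eq_false (hd : 1 ≤ d) (θ μ x : EuclideanSpace ℝ (Fin d))
    (hx : 0 ≤ score θ μ x) {k : ℕ} (hk : 1 ≤ k) (hkn : k ≤ n)
    (hks : 2 * (k : ℝ) * score θ μ x ^ 2 ≤ 1) :
    1 ≤ 8 * Measure.pi (fun _ : Fin n => modelLaw θ μ) {S | knn k S x = false} := by
  set Q := Measure.pi (fun _ : Fin n => modelLaw θ μ)
  set F : Finset (Finset (Fin n)) := Finset.univ.filter fun J => J.card = k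
  have hF : ∀ J, J ∈ F ↔ J.card = k := fun J => by simp [F]
  have hcover : 1 ≤ Q (⋃ J ∈ F, nearestEvent x J) := by
    rw [← measure_univ (μ := Q)]
    refine measure_mono_ae ?_
    filter_upwards [ae_injective_norm_sub hd θ μ x] with S hS _
    obtain ⟨J, hJ, hSJ⟩ := exists_mem_nearestEvent x hkn hS
    exact Set.mem_biUnion ((hF J).2 hJ) hSJ
  -- The sorting permutation determines the nearest set of size `k`, so the local bounds add up
  -- without overlap.
  have hdisj : Set.PairwiseDisjoint (F : Set (Finset (Fin n)))
      fun J => nearestEvent x J ∩ minorityEvent d J := by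
    intro J hJ J' hJ' hne
    rw [Function.onFun, Set.disjoint_left]
    rintro S ⟨hS, -⟩ ⟨hS', -⟩
    apply hne
    have h1 := image_order_eq x hS
    have h2 := image_order_eq x hS'
    rw [(hF J).1 hJ] at h1
    rw [(hF J').1 hJ'] at h2
    rw [← h1, h2]
  have hsub : (⋃ J ∈ F, nearestEvent x J ∩ minorityEvent d J) ⊆ {S | knn k S x = false} := by
    intro S hS
    simp only [Set.mem_iUnion] at hS
    obtain ⟨J, hJ, hS1, hS2⟩ := hS
    rw [hF] at hJ
    subst hJ
    exact (knn_eq_false_iff x hk hS1).2 hS2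
  calc 1 ≤ Q (⋃ J ∈ F, nearestEvent x J) := hcover
    _ ≤ ∑ J ∈ F, Q (nearestEvent x J) := measure_biUnion_finset_le _ _
    _ ≤ ∑ J ∈ F, 8 * Q (nearestEvent x J ∩ minorityEvent d J) := by
      refine Finset.sum_le_sum fun J hJ => pi_nearestEvent_le θ μ x hx J ?_
      rw [(hF J).1 hJ]
      exact hks
    _ = 8 * Q (⋃ J ∈ F, nearestEvent x J ∩ minorityEvent d J) := by
      rw [measure_biUnion_finset hdisj fun J _ =>
        (measurableSet_nearestEvent x J).inter (measurableSet_minorityEvent J), Finset.mul_sum]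
    _ ≤ _ := by gcongr

end Nearest

/-! ### Measurability of the nearest neighbours classifier -/

section Measurability

variable {d n : ℕ}

/-- The sorting permutation is characterized by finitely many comparisons: nondecreasing distances,
and increasing indices among ties. -/
lemma measurableSet_order_eq (σ : Equiv.Perm (Fin n)) :
    MeasurableSet {p : (Fin n → EuclideanSpace ℝ (Fin d) × Bool) × EuclideanSpace ℝ (Fin d) |
      order p.1 p.2 = σ} := by
  have hf : ∀ i, Measurable
      fun p : (Fin n → EuclideanSpace ℝ (Fin d) × Bool) × EuclideanSpace ℝ (Fin d) =>
        ‖(p.1 i).1 - p.2‖ := fun i => by fun_prop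
  simp only [order, eq_comm (b := σ), Tuple.eq_sort_iff, Monotone, Function.comp_apply]
  refine MeasurableSet.inter (s₁ := {_p | _}) (s₂ := {_p | _}) ?_ ?_
  · simp only [Set.ofPred_forall]
    exact MeasurableSet.iInter fun i => MeasurableSet.iInter fun j => MeasurableSet.iInter fun _ =>
      measurableSet_le (hf _) (hf _)
  · simp only [Set.ofPred_forall]
    refine MeasurableSet.iInter fun i => MeasurableSet.iInter fun j => MeasurableSet.iInter fun _ =>
      ?_
    by_cases h : σ i < σ j
    · simp [h]
    · simp only [h, imp_false]
      exact (measurableSet_eq_fun (hf _) (hf _)).compl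

/-- Once the permutation is fixed, the answer is a function of the label vector, which takes
finitely many values. -/
lemma measurable_knn (k : ℕ) :
    Measurable fun p : (Fin n → EuclideanSpace ℝ (Fin d) × Bool) × EuclideanSpace ℝ (Fin d) =>
      knn k p.1 p.2 := by
  refine measurable_to_bool ?_
  have : (fun p : (Fin n → EuclideanSpace ℝ (Fin d) × Bool) × EuclideanSpace ℝ (Fin d) =>
      knn k p.1 p.2) ⁻¹' {true} = ⋃ σ : Equiv.Perm (Fin n), {p | order p.1 p.2 = σ} ∩
        {p | (fun i => (p.1 i).2) ∈ {y : Fin n → Bool | (1 / 2 : ℝ) <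
          (1 / (k : ℝ)) * ∑ j : Fin n with j.val < k, (if y (σ j) then (1 : ℝ) else 0)}} := by
    ext p
    simp [knn]
  rw [this]
  exact MeasurableSet.iUnion fun σ => (measurableSet_order_eq σ).inter
    (measurableSet_mem_of_finite (by fun_prop) _)

end Measurability

/-! ### Integral formula for the excess risk -/

section Risk

variable {d n : ℕ}

/-- The probability, over the sample, that the classifier `Φ` answers `0` at `x`. -/
noncomputable def probFalse (θ μ : EuclideanSpace ℝ (Fin d))
    (Φ : (Fin n → EuclideanSpace ℝ (Fin d) × Bool) → EuclideanSpace ℝ (Fin d) → Bool)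
    (x : EuclideanSpace ℝ (Fin d)) : ℝ :=
  (Measure.pi (fun _ : Fin n => modelLaw θ μ)).real {S | Φ S x = false}

variable {θ μ : EuclideanSpace ℝ (Fin d)}
  {Φ Ψ : (Fin n → EuclideanSpace ℝ (Fin d) × Bool) → EuclideanSpace ℝ (Fin d) → Bool}

lemma measurable_probFalse (hΦ : Measurable fun p :
    (Fin n → EuclideanSpace ℝ (Fin d) × Bool) × EuclideanSpace ℝ (Fin d) => Φ p.1 p.2) :
    Measurable (probFalse θ μ Φ) :=
  (measurable_measure_prodMk_right (hΦ (measurableSet_singleton false))).ennreal_toReal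

lemma probFalse_nonneg (x : EuclideanSpace ℝ (Fin d)) : 0 ≤ probFalse θ μ Φ x :=
  measureReal_nonneg

lemma probFalse_le_one (x : EuclideanSpace ℝ (Fin d)) : probFalse θ μ Φ x ≤ 1 :=
  measureReal_le_one

lemma lintegral_modelLaw (f : EuclideanSpace ℝ (Fin d) × Bool → ℝ≥0∞) (hf : Measurable f) :
    ∫⁻ z, f z ∂modelLaw θ μ =
      2⁻¹ * ∫⁻ x, f (x, true) ∂gaussianAt θ + 2⁻¹ * ∫⁻ x, f (x, false) ∂gaussianAt μ := by
  rw [modelLaw, lintegral_add_measure, lintegral_smul_measure, lintegral_smul_measure,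
    lintegral_map hf (by fun_prop), lintegral_map hf (by fun_prop), smul_eq_mul, smul_eq_mul]

lemma risk_eq (hΦ : Measurable fun p :
    (Fin n → EuclideanSpace ℝ (Fin d) × Bool) × EuclideanSpace ℝ (Fin d) => Φ p.1 p.2) :
    risk θ μ Φ = 2⁻¹ * ∫ x, probFalse θ μ Φ x ∂gaussianAt θ +
      2⁻¹ * ∫ x, (1 - probFalse θ μ Φ x) ∂gaussianAt μ := by
  set Q := Measure.pi (fun _ : Fin n => modelLaw θ μ) with hQ
  have hM : MeasurableSet {ω : (Fin n → EuclideanSpace ℝ (Fin d) × Bool) ×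
      (EuclideanSpace ℝ (Fin d) × Bool) | Φ ω.1 ω.2.1 ≠ ω.2.2} := by
    have h1 : Measurable fun ω : (Fin n → EuclideanSpace ℝ (Fin d) × Bool) ×
        (EuclideanSpace ℝ (Fin d) × Bool) => Φ ω.1 ω.2.1 :=
      hΦ.comp (g := fun p : (Fin n → EuclideanSpace ℝ (Fin d) × Bool) ×
        EuclideanSpace ℝ (Fin d) => Φ p.1 p.2) (by fun_prop : Measurable fun ω :
        (Fin n → EuclideanSpace ℝ (Fin d) × Bool) × (EuclideanSpace ℝ (Fin d) × Bool) =>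
          (ω.1, ω.2.1))
    exact (measurableSet_eq_fun h1 (by fun_prop)).compl
  have hsec : ∀ x, MeasurableSet {S | Φ S x = false} := fun x =>
    (hΦ.comp measurable_prodMk_right) (measurableSet_singleton false)
  have hmeas := measurable_probFalse (θ := θ) (μ := μ) hΦ
  have hbd : ∀ x, |probFalse θ μ Φ x| ≤ 1 := fun x => by
    rw [abs_of_nonneg (probFalse_nonneg x)]
    exact probFalse_le_one x
  rw [risk, measureReal_def, Measure.prod_apply_symm hM,
    lintegral_modelLaw _ (measurable_measure_prodMk_right hM)]
  have h1 : ∀ x, Q ((fun S => (S, (x, true))) ⁻¹' {ω | Φ ω.1 ω.2.1 ≠ ω.2.2}) =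
      ENNReal.ofReal (probFalse θ μ Φ x) := by
    intro x
    rw [probFalse, ofReal_measureReal]
    congr 1
    ext S
    simp
  have h2 : ∀ x, Q ((fun S => (S, (x, false))) ⁻¹' {ω | Φ ω.1 ω.2.1 ≠ ω.2.2}) =
      ENNReal.ofReal (1 - probFalse θ μ Φ x) := by
    intro x
    rw [probFalse, ← probReal_compl_eq_one_sub (hsec x), ofReal_measureReal]
    congr 1
  simp_rw [← hQ, h1, h2]
  have hi1 : Integrable (probFalse θ μ Φ) (gaussianAt θ) :=
    Integrable.of_bound hmeas.aestronglyMeasurable 1 (ae_of_all _ hbd)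
  have hi2 : Integrable (fun x => 1 - probFalse θ μ Φ x) (gaussianAt μ) :=
    (integrable_const 1).sub
      (Integrable.of_bound hmeas.aestronglyMeasurable 1 (ae_of_all _ hbd))
  rw [← ofReal_integral_eq_lintegral_ofReal hi1 (ae_of_all _ probFalse_nonneg),
    ← ofReal_integral_eq_lintegral_ofReal hi2
      (ae_of_all _ fun x => sub_nonneg.2 (probFalse_le_one x)),
    ENNReal.toReal_add (by finiteness) (by finiteness), ENNReal.toReal_mul, ENNReal.toReal_mul,
    ENNReal.toReal_ofReal (integral_nonneg probFalse_nonneg),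
    ENNReal.toReal_ofReal (integral_nonneg fun x => sub_nonneg.2 (probFalse_le_one x))]
  simp

lemma integrable_gaussianDensity_mul_probFalse (a : EuclideanSpace ℝ (Fin d))
    (hΦ : Measurable fun p :
      (Fin n → EuclideanSpace ℝ (Fin d) × Bool) × EuclideanSpace ℝ (Fin d) => Φ p.1 p.2) :
    Integrable fun x => gaussianDensity (x - a) * probFalse θ μ Φ x := by
  refine (integrable_gaussianDensity_sub a).mul_bdd (c := 1)
    (measurable_probFalse hΦ).aestronglyMeasurable (ae_of_all _ fun x => ?_)
  rw [Real.norm_eq_abs, abs_of_nonneg (probFalse_nonneg x)]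
  exact probFalse_le_one x

/-- The difference of the risks of two classifiers. -/
lemma risk_sub_risk (hΦ : Measurable fun p :
      (Fin n → EuclideanSpace ℝ (Fin d) × Bool) × EuclideanSpace ℝ (Fin d) => Φ p.1 p.2)
    (hΨ : Measurable fun p :
      (Fin n → EuclideanSpace ℝ (Fin d) × Bool) × EuclideanSpace ℝ (Fin d) => Ψ p.1 p.2) :
    Integrable (fun x => (gaussianDensity (x - θ) - gaussianDensity (x - μ)) *
        (probFalse θ μ Φ x - probFalse θ μ Ψ x)) ∧
      risk θ μ Φ - risk θ μ Ψ =
        2⁻¹ * ∫ x, (gaussianDensity (x - θ) - gaussianDensity (x - μ)) *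
          (probFalse θ μ Φ x - probFalse θ μ Ψ x) := by
  have i1 := integrable_gaussianDensity_mul_probFalse (θ := θ) (μ := μ) θ hΦ
  have i2 := integrable_gaussianDensity_mul_probFalse (θ := θ) (μ := μ) μ hΦ
  have i3 := integrable_gaussianDensity_mul_probFalse (θ := θ) (μ := μ) θ hΨ
  have i4 := integrable_gaussianDensity_mul_probFalse (θ := θ) (μ := μ) μ hΨ
  have i0 := integrable_gaussianDensity_sub μ
  have e : (fun x => (gaussianDensity (x - θ) - gaussianDensity (x - μ)) *
      (probFalse θ μ Φ x - probFalse θ μ Ψ x)) = fun x =>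
      (gaussianDensity (x - θ) * probFalse θ μ Φ x - gaussianDensity (x - θ) * probFalse θ μ Ψ x) -
      (gaussianDensity (x - μ) * probFalse θ μ Φ x - gaussianDensity (x - μ) * probFalse θ μ Ψ x) :=
    by ext x; ring
  rw [e]
  refine ⟨(i1.sub i3).sub (i2.sub i4), ?_⟩
  have h := integral_sub (i1.sub i3) (i2.sub i4)
  simp only [Pi.sub_apply] at h
  rw [risk_eq hΦ, risk_eq hΨ, h, integral_sub i1 i3, integral_sub i2 i4]
  simp_rw [integral_gaussianAt, mul_sub, mul_one]
  rw [integral_sub i0 i2, integral_sub i0 i4]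
  ring

lemma probFalse_bayes (x : EuclideanSpace ℝ (Fin d)) :
    probFalse (n := n) θ μ (fun _ => bayes θ μ) x = if score θ μ x < 0 then 1 else 0 := by
  simp only [probFalse, bayes_eq_false_iff]
  split_ifs with h <;> simp [h]

lemma measurable_bayes (θ μ : EuclideanSpace ℝ (Fin d)) : Measurable (bayes θ μ) := by
  refine measurable_to_bool ?_
  have : bayes θ μ ⁻¹' {true} = {x | 0 ≤ score θ μ x} := by
    ext x
    simp [bayes, ← regression_ge_half_iff]
  rw [this]
  exact measurableSet_le measurable_const (by fun_prop)

end Risk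

/-! ### Mass of the strip and lower bound for the excess risk -/

section Strip

variable {d n : ℕ}

lemma map_inner_stdGaussian (D : EuclideanSpace ℝ (Fin d)) :
    (stdGaussian (EuclideanSpace ℝ (Fin d))).map (fun z => ⟪D, z⟫) =
      gaussianReal 0 (‖D‖₊ ^ 2) := by
  have h := IsGaussian.map_eq_gaussianReal (μ := stdGaussian (EuclideanSpace ℝ (Fin d)))
    (innerSL ℝ D)
  rw [integral_strongDual_stdGaussian, variance_dual_stdGaussian, innerSL_apply_norm] at h
  have hv : ‖D‖₊ ^ 2 = (‖D‖ ^ 2).toNNReal := by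
    ext
    rw [Real.coe_toNNReal _ (by positivity)]
    simp
  rw [hv, ← h]
  rfl

lemma gaussianPDFReal_anti {v : NNReal} {a b : ℝ} (ha : 0 ≤ a) (hab : a ≤ b) :
    gaussianPDFReal 0 v b ≤ gaussianPDFReal 0 v a := by
  unfold gaussianPDFReal
  rw [sub_zero, sub_zero]
  gcongr

/-- The centred density decreases on the half-line, so its minimum on the interval is at `b`. -/
lemma mul_gaussianPDFReal_le {v : NNReal} (hv : v ≠ 0) {a b : ℝ} (ha : 0 ≤ a) :
    ENNReal.ofReal ((b - a) * gaussianPDFReal 0 v b) ≤ gaussianReal 0 v (Set.Icc a b) := by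
  rw [gaussianReal_apply 0 hv, mul_comm, ENNReal.ofReal_mul (gaussianPDFReal_nonneg _ _ _),
    ← Real.volume_Icc, ← setLIntegral_const]
  refine setLIntegral_mono (measurable_gaussianPDF _ _) fun y hy => ?_
  exact ENNReal.ofReal_le_ofReal (gaussianPDFReal_anti (ha.trans hy.1) hy.2)

/-- The mass of a strip parallel to the decision boundary. -/
lemma mul_gaussianPDFReal_le_gaussianAt_strip {θ μ : EuclideanSpace ℝ (Fin d)} (hne : θ ≠ μ)
    {ε : ℝ} (hε : 0 ≤ ε) (hε1 : ε ≤ 1) :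
    ε / 2 * gaussianPDFReal 0 (‖θ - μ‖₊ ^ 2) (‖θ - μ‖ ^ 2 / 2 + 1) ≤
      (gaussianAt μ).real (score θ μ ⁻¹' Set.Icc (ε / 2) ε) := by
  have hD : ‖θ - μ‖₊ ^ 2 ≠ 0 := by simpa [sub_eq_zero] using hne
  set a := ‖θ - μ‖ ^ 2 / 2 with ha
  have ha0 : 0 ≤ a := by positivity
  -- Under `N(μ, I_d)` the score is a real Gaussian of mean `-‖θ - μ‖² / 2` and variance `‖θ - μ‖²`;
  -- this removes the dimension.
  have hscore : ∀ z, score θ μ (μ + z) = ⟪θ - μ, z⟫ - a := by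
    intro z
    rw [score_add_right, score, show μ - (2⁻¹ : ℝ) • (θ + μ) = (-(2⁻¹) : ℝ) • (θ - μ) by module,
      inner_smul_left, real_inner_self_eq_norm_sq, ha]
    simp
    ring
  have hset : MeasurableSet (score θ μ ⁻¹' Set.Icc (ε / 2) ε) :=
    measurableSet_Icc.preimage (by fun_prop)
  have h1 : gaussianAt μ (score θ μ ⁻¹' Set.Icc (ε / 2) ε) =
      gaussianReal 0 (‖θ - μ‖₊ ^ 2) (Set.Icc (a + ε / 2) (a + ε)) := by
    rw [gaussianAt, Measure.map_apply (by fun_prop) hset, ← map_inner_stdGaussian,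
      Measure.map_apply (by fun_prop) measurableSet_Icc]
    congr 1
    ext z
    simp only [Set.mem_preimage, hscore, Set.mem_Icc]
    constructor <;> rintro ⟨h, h'⟩ <;> constructor <;> linarith
  have h2 := mul_gaussianPDFReal_le hD (a := a + ε / 2) (b := a + ε) (by positivity)
  rw [← h1] at h2
  rw [measureReal_def, ← ENNReal.ofReal_le_iff_le_toReal (by finiteness)]
  refine (ENNReal.ofReal_le_ofReal ?_).trans h2
  rw [show a + ε - (a + ε / 2) = ε / 2 by ring]
  gcongr
  exact gaussianPDFReal_anti (by positivity) (by linarith)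

/-- The excess risk of the nearest neighbours classifier, for every number of neighbours. -/
theorem le_risk_knn_sub_risk_bayes (hd : 1 ≤ d) {θ μ : EuclideanSpace ℝ (Fin d)} (hne : θ ≠ μ)
    {k : ℕ} (hk : 1 ≤ k) (hkn : k ≤ n) :
    gaussianPDFReal 0 (‖θ - μ‖₊ ^ 2) (‖θ - μ‖ ^ 2 / 2 + 1) / 256 / k ≤
      risk (n := n) θ μ (knn k) - risk (n := n) θ μ (fun _ => bayes θ μ) := by
  obtain ⟨hint, heq⟩ := risk_sub_risk (n := n) (θ := θ) (μ := μ) (Φ := knn k)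
    (Ψ := fun _ => bayes θ μ) (measurable_knn k) ((measurable_bayes θ μ).comp measurable_snd)
  have hk0 : (1 : ℝ) ≤ k := by exact_mod_cast hk
  have hsq : √(k : ℝ) ^ 2 = k := Real.sq_sqrt (by positivity)
  have hsq1 : 1 ≤ √(k : ℝ) := Real.one_le_sqrt.2 hk0
  -- Small enough that `2 * k * ε² = 1/2 ≤ 1`, as the bound `1/8` on the error probability requires.
  set ε : ℝ := 1 / (2 * √(k : ℝ)) with hεdef
  have hε : 0 < ε := by positivity
  have hε1 : ε ≤ 1 := by
    rw [hεdef, div_le_one (by positivity)]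
    linarith
  have hεk : ε ^ 2 = 1 / (4 * k) := by
    rw [hεdef, div_pow, mul_pow, hsq]
    norm_num
  set A := score θ μ ⁻¹' Set.Icc (ε / 2) ε with hA
  have hAm : MeasurableSet A := measurableSet_Icc.preimage (by fun_prop)
  -- `ε / 16 = (ε / 2) * (1 / 8)`: the least relative density gap on the strip times the error
  -- probability.
  have hpt : ∀ x, gaussianDensity (x - μ) * A.indicator (fun _ => ε / 16) x ≤
      (gaussianDensity (x - θ) - gaussianDensity (x - μ)) *
        (probFalse (n := n) θ μ (knn k) x -
          probFalse (n := n) θ μ (fun _ => bayes θ μ) x) := by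
    intro x
    have hg := gaussianDensity_pos (x - μ)
    have hq0 := probFalse_nonneg (θ := θ) (μ := μ) (Φ := knn (n := n) k) x
    have hq1 := probFalse_le_one (θ := θ) (μ := μ) (Φ := knn (n := n) k) x
    have hexp := Real.add_one_le_exp (score θ μ x)
    rw [probFalse_bayes, gaussianDensity_sub_eq θ μ x]
    by_cases hx : x ∈ A
    · have hs0 : 0 ≤ score θ μ x := by linarith [hx.1]
      have hq : 1 / 8 ≤ probFalse (n := n) θ μ (knn k) x := by
        have hks : 2 * (k : ℝ) * score θ μ x ^ 2 ≤ 1 := by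
          calc 2 * (k : ℝ) * score θ μ x ^ 2 ≤ 2 * k * ε ^ 2 := by
                gcongr
                exact hx.2
            _ ≤ 1 := by
                rw [hεk]
                field_simp
                norm_num
        have h := one_le_eight_mul_pi_knn_eq_false hd θ μ x hs0 hk hkn hks
        have h' := ENNReal.toReal_mono (by finiteness) h
        rw [ENNReal.toReal_mul, ENNReal.toReal_one] at h'
        have h8 : (8 : ℝ≥0∞).toReal = 8 := by simp
        rw [h8] at h'
        rw [probFalse, measureReal_def]
        linarith
      rw [Set.indicator_of_mem hx, if_neg (not_lt.2 hs0), sub_zero]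
      have h1 : gaussianDensity (x - μ) * (ε / 2) ≤
          Real.exp (score θ μ x) * gaussianDensity (x - μ) - gaussianDensity (x - μ) := by
        nlinarith [hx.1]
      calc gaussianDensity (x - μ) * (ε / 16) = gaussianDensity (x - μ) * (ε / 2) * (1 / 8) := by
            ring
        _ ≤ _ := mul_le_mul h1 hq (by norm_num) (le_trans (by positivity) h1)
    · rw [Set.indicator_of_notMem hx, mul_zero]
      -- Off the strip only the sign matters: the two factors never have opposite signs, by
      -- optimality of the Bayes rule.
      split_ifs with hs
      · have : Real.exp (score θ μ x) ≤ 1 := Real.exp_le_one_iff.2 hs.le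
        exact mul_nonneg_of_nonpos_of_nonpos (by nlinarith) (by linarith)
      · have : 1 ≤ Real.exp (score θ μ x) := Real.one_le_exp (not_lt.1 hs)
        exact mul_nonneg (by nlinarith) (by linarith)
  have hlow : ε / 16 * (gaussianAt μ).real A ≤
      ∫ x, (gaussianDensity (x - θ) - gaussianDensity (x - μ)) *
        (probFalse (n := n) θ μ (knn k) x -
          probFalse (n := n) θ μ (fun _ => bayes θ μ) x) := by
    have h1 : ε / 16 * (gaussianAt μ).real A =
        ∫ x, gaussianDensity (x - μ) * A.indicator (fun _ => ε / 16) x := by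
      rw [← integral_gaussianAt, integral_indicator_const _ hAm, smul_eq_mul, mul_comm]
    rw [h1]
    refine integral_mono ?_ hint hpt
    refine (integrable_gaussianDensity_sub μ).mul_bdd (c := ε / 16)
      (measurable_const.indicator hAm).aestronglyMeasurable (ae_of_all _ fun x => ?_)
    rw [Real.norm_eq_abs, abs_of_nonneg (Set.indicator_nonneg (fun _ _ => by positivity) x)]
    exact Set.indicator_le_self' (fun _ _ => by positivity) x
  have hstrip := mul_gaussianPDFReal_le_gaussianAt_strip hne hε.le hε1
  rw [heq]
  set p := gaussianPDFReal 0 (‖θ - μ‖₊ ^ 2) (‖θ - μ‖ ^ 2 / 2 + 1)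
  calc p / 256 / k = 2⁻¹ * (ε / 16 * (ε / 2 * p)) := by
        rw [show 2⁻¹ * (ε / 16 * (ε / 2 * p)) = ε ^ 2 * p / 64 by ring, hεk]
        field_simp
        ring
    _ ≤ 2⁻¹ * (ε / 16 * (gaussianAt μ).real A) := by gcongr
    _ ≤ _ := by gcongr

end Strip

/-! ### The standard choice of the number of neighbours -/

section NeighbourRange

theorem floor_mem_neighbourRange {d : ℕ} (hd : 1 ≤ d) {c : ℝ} (hc : 0 < c)
    (hcd : c ≤ (d : ℝ) ^ (-(2 * (d : ℝ) / (4 + (d : ℝ))))) {n : ℕ}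
    (hn : 1 ≤ c * (n : ℝ) ^ (4 / (4 + (d : ℝ)))) :
    ⌊c * (n : ℝ) ^ (4 / (4 + (d : ℝ)))⌋₊ ∈ neighbourRange d n := by
  have hd1 : (1 : ℝ) ≤ d := by exact_mod_cast hd
  have hd0 : (0 : ℝ) < d := by linarith
  have hn1 : 1 ≤ n := by
    rcases Nat.eq_zero_or_pos n with rfl | h
    · rw [Nat.cast_zero, Real.zero_rpow (by positivity), mul_zero] at hn
      exact absurd hn (by norm_num)
    · exact h
  have hnr : (1 : ℝ) ≤ n := by exact_mod_cast hn1
  have hn0 : (0 : ℝ) < n := by linarith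
  set m := c * (n : ℝ) ^ (4 / (4 + (d : ℝ))) with hm
  have hkm : (⌊m⌋₊ : ℝ) ≤ m := Nat.floor_le (by linarith)
  have hk1 : 1 ≤ ⌊m⌋₊ := Nat.le_floor (by simpa using hn)
  have hk1' : (1 : ℝ) ≤ ⌊m⌋₊ := by exact_mod_cast hk1
  set k := ⌊m⌋₊
  have hc1 : c ≤ 1 := hcd.trans
    (Real.rpow_le_one_of_one_le_of_nonpos hd1 (neg_nonpos.2 (by positivity)))
  have hmn : m ≤ n := by
    have h1 : (n : ℝ) ^ (4 / (4 + (d : ℝ))) ≤ (n : ℝ) ^ (1 : ℝ) :=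
      Real.rpow_le_rpow_of_exponent_le hnr (by rw [div_le_one (by positivity)]; linarith)
    rw [Real.rpow_one] at h1
    calc m ≤ 1 * n := mul_le_mul hc1 h1 (by positivity) zero_le_one
      _ = n := one_mul _
  refine ⟨hk1, by exact_mod_cast hkm.trans hmn, ?_⟩
  have hm0 : 0 < m := by linarith
  rw [le_div_iff₀ (Real.sqrt_pos.2 (by linarith))]
  -- The exponents add up to `(4 + d) / (2d)`, which turns `n ^ (4 / (4 + d))` into `n ^ (2 / d)`
  -- and cancels the sample size.
  have hexp : m ^ (2 / (d : ℝ)) * m ^ (1 / 2 : ℝ) =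
      c ^ ((4 + (d : ℝ)) / (2 * d)) * (n : ℝ) ^ (2 / (d : ℝ)) := by
    rw [← Real.rpow_add hm0, hm, Real.mul_rpow hc.le (by positivity), ← Real.rpow_mul hn0.le]
    congr 2 <;> field_simp <;> ring
  have hcpow : c ^ ((4 + (d : ℝ)) / (2 * d)) ≤ (d : ℝ)⁻¹ := by
    calc c ^ ((4 + (d : ℝ)) / (2 * d)) ≤
        ((d : ℝ) ^ (-(2 * (d : ℝ) / (4 + (d : ℝ))))) ^ ((4 + (d : ℝ)) / (2 * d)) := by gcongr
      _ = (d : ℝ)⁻¹ := by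
        rw [← Real.rpow_mul hd0.le, ← Real.rpow_neg_one]
        congr 1
        field_simp
  -- The left side increases with `k`, so the floor may be replaced by `m`; the bound on `c` is what
  -- makes the result at most `1`.
  calc (d : ℝ) * ((k : ℝ) / n) ^ (2 / (d : ℝ)) * √(k : ℝ) ≤
      d * (m / n) ^ (2 / (d : ℝ)) * √m := by gcongr
    _ = d * (m ^ (2 / (d : ℝ)) * m ^ (1 / 2 : ℝ)) / (n : ℝ) ^ (2 / (d : ℝ)) := by
      rw [Real.div_rpow hm0.le hn0.le, Real.sqrt_eq_rpow]
      ring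
    _ = d * c ^ ((4 + (d : ℝ)) / (2 * d)) := by
      rw [hexp]
      field_simp
    _ ≤ d * (d : ℝ)⁻¹ := by gcongr
    _ = 1 := mul_inv_cancel₀ hd0.ne'

end NeighbourRange

end GaussianKNN

theorem proposition4 :
    (∀ Δ : ℝ, 0 < Δ → ∃ C₁ : ℝ, 0 < C₁ ∧
      ∀ d : ℕ, 1 ≤ d → ∀ θ μ : EuclideanSpace ℝ (Fin d), ‖θ - μ‖ = Δ →
        ∀ n k : ℕ, k ∈ GaussianKNN.neighbourRange d n →
          C₁ / (k : ℝ) ≤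
            GaussianKNN.risk (n := n) θ μ (GaussianKNN.knn k) -
              GaussianKNN.risk (n := n) θ μ (fun _ => GaussianKNN.bayes θ μ)) ∧
    (∀ d : ℕ, 1 ≤ d → ∀ c : ℝ, 0 < c → c ≤ (d : ℝ) ^ (-(2 * (d : ℝ) / (4 + (d : ℝ)))) →
      ∀ n : ℕ, 1 ≤ c * (n : ℝ) ^ (4 / (4 + (d : ℝ))) →
        ⌊c * (n : ℝ) ^ (4 / (4 + (d : ℝ)))⌋₊ ∈ GaussianKNN.neighbourRange d n) := by
  -- The density of `N(0, Δ²)` at a point beyond every strip, since `ε ≤ 1`; and `(1/2) * (ε/16) *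
  -- (ε/2) = 1/(256 k)`.
  refine ⟨fun Δ hΔ => ⟨gaussianPDFReal 0 (Δ.toNNReal ^ 2) (Δ ^ 2 / 2 + 1) / 256, ?_, ?_⟩,
    fun d hd c hc hcd n hn => GaussianKNN.floor_mem_neighbourRange hd hc hcd hn⟩
  · have h : Δ.toNNReal ^ 2 ≠ 0 := pow_ne_zero 2 (by simpa using hΔ)
    have := gaussianPDFReal_pos 0 _ (Δ ^ 2 / 2 + 1) h
    positivity
  · rintro d hd θ μ rfl n k ⟨hk, hkn, -⟩
    rw [norm_toNNReal]
    exact GaussianKNN.le_risk_knn_sub_risk_bayes hd (sub_ne_zero.1 (norm_pos_iff.1 hΔ)) hk hkn
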